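/- Let $(X,d)$ be a metric space, and fix one of the two kinds of balls: either all balls below are open, $B(x,r)=\{y: d(x,y)<r\}$, or all are closed, $B(x,r)=\{y: d(x,y)\le r\}$; radii are positive, and a ball always comes with a chosen center and a chosen radius. For $A\subset X$ and $R>0$, a centered cover of $A$ with radii at most $R$ is a collection $\mathcal C$ of balls $B(x,r)$ with $x\in A$, $0<r\le R$, such that every $x\in A$ is the center of at least one ball of $\mathcal C$. For positive integers $D, L$, the space $X$ - is geometrically doubling with constant $D$ if every ball of radius $r$ can be covered by at most $D$ balls of radius $r/2$; - has the Besicovitch intersection property with constant $L$ if $\sum_{B\in\mathcal C}\mathbf 1_{B}\le L$ for every collection $\mathcal C$ of balls (finite or infinite) such that $x\notin B(y,s)$ and $y\notin B(x,r)$ for all distinct $B(x,r),B(y,s)\in\mathcal C$; - has the Besicovitch covering property with constant $L$ if for every $R>0$, every $A\subset X$ and every centered cover $\mathcal C$ of $A$ with radii at most $R$ there is $\mathcal C'\subset\mathcal C$ with $\mathbf 1_A\le\sum_{B\in\mathcal C'}\mathbf 1_{B}\le L$; - has the strong Besicovitch covering property with constant $L$ if for every $R>0$, every $A\subset X$ and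 every centered cover $\mathcal C$ of $A$ with radii at most $R$ there are, for some $m\le L$, subcollections $\mathcal C_1,\dots,\mathcal C_m\subset\mathcal C$, each consisting of pairwise disjoint balls, with $A\subset\bigcup_{i=1}^m\bigcup\mathcal C_i$; - has the approximate midpoint property if for all $\varepsilon>0$ and $x,y\in X$ there is $z\in X$ with $d(x,z)<\varepsilon+d(x,y)/2$ and $d(z,y)<\varepsilon+d(x,y)/2$. **Theorem.** Let $(X,d)$ be geometrically doubling with constant $D$, and let $L$ be a positive integer. (1) If $X$ has the Besicovitch intersection property with constant $L$, then $X$ has the Besicovitch covering property with constant $LD^3$. (2) If $X$ has the Besicovitch covering property with constant $LD^3$ and has the approximate midpoint property, then $X$ has the strong Besicovitch covering property with constant $LD^6+1$. -/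

import Mathlib

open scoped ENNReal

/-- The two kinds of metric balls. In every statement all balls are of one and the same kind. -/
inductive BallKind : Type
  | metricOpen : BallKind
  | metricClosed : BallKind

namespace BesicovitchTypes

/-- The ball of kind `κ` with center `p.1` and radius `p.2`. A ball always comes with a chosen
center and a chosen radius, so collections of balls are sets of pairs `(center, radius)`. -/
def nball {X : Type*} [MetricSpace X] (κ : BallKind) (p : X × ℝ) : Set X :=
  match κ with
  | BallKind.metricOpen => {y | dist p.1 y < p.2}
  | BallKind.metricClosed => {y | dist p.1 y ≤ p.2}

/-- The function `y ↦ ∑_{B ∈ C} 1_B(y)`, with values in `[0, ∞]`. -/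
noncomputable def overlap {X : Type*} [MetricSpace X] (κ : BallKind) (C : Set (X × ℝ))
    (y : X) : ℝ≥0∞ :=
  ∑' p : C, (nball κ (p : X × ℝ)).indicator (fun _ => (1 : ℝ≥0∞)) y

/-- The overlap function counts the balls of the collection that contain the given point. -/
theorem overlap_eq_encard {X : Type*} [MetricSpace X] (κ : BallKind) (C : Set (X × ℝ)) (y : X) :
    overlap κ C y = ({p ∈ C | y ∈ nball κ p}.encard : ℝ≥0∞) := by
  rw [← ENNReal.tsum_set_one, tsum_subtype {p ∈ C | y ∈ nball κ p} (fun _ => (1 : ℝ≥0∞)), overlap,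
    tsum_subtype C (fun p => (nball κ p).indicator (fun _ => (1 : ℝ≥0∞)) y)]
  refine tsum_congr fun p => ?_
  by_cases h1 : p ∈ C <;> by_cases h2 : y ∈ nball κ p <;> simp [h1, h2]

/-- `C` is a collection of balls with centers in `A` and radii in `(0, R]`, such that each point
of `A` is the center of at least one ball of `C`. -/
def IsCenteredCover {X : Type*} (A : Set X) (R : ℝ) (C : Set (X × ℝ)) : Prop :=
  (∀ p ∈ C, p.1 ∈ A ∧ 0 < p.2 ∧ p.2 ≤ R) ∧ ∀ x ∈ A, ∃ r : ℝ, (x, r) ∈ C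

/-- The strong Besicovitch covering property with constant `L`. -/
def StrongCoveringProperty (X : Type*) [MetricSpace X] (κ : BallKind) (L : ℕ) : Prop :=
  1 ≤ L ∧ ∀ R : ℝ, 0 < R → ∀ (A : Set X) (C : Set (X × ℝ)), IsCenteredCover A R C →
    ∃ m : ℕ, m ≤ L ∧ ∃ E : Fin m → Set (X × ℝ),
      (∀ i, E i ⊆ C ∧ (E i).PairwiseDisjoint (nball κ)) ∧
      A ⊆ ⋃ i, ⋃ p ∈ E i, nball κ p

/-- The Besicovitch covering property with constant `L`. -/
def CoveringProperty (X : Type*) [MetricSpace X] (κ : BallKind) (L : ℕ) : Prop :=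
  1 ≤ L ∧ ∀ R : ℝ, 0 < R → ∀ (A : Set X) (C : Set (X × ℝ)), IsCenteredCover A R C →
    ∃ C' : Set (X × ℝ), C' ⊆ C ∧ ∀ y : X,
      A.indicator (fun _ => (1 : ℝ≥0∞)) y ≤ overlap κ C' y ∧ overlap κ C' y ≤ (L : ℝ≥0∞)

/-- A Besicovitch family: a (possibly infinite) collection of balls, with no bound on the radii,
such that no ball of the collection contains the center of another one. -/
def IsBesicovitchFamily {X : Type*} [MetricSpace X] (κ : BallKind) (C : Set (X × ℝ)) : Prop :=
  (∀ p ∈ C, 0 < p.2) ∧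
    ∀ p ∈ C, ∀ q ∈ C, p ≠ q → p.1 ∉ nball κ q ∧ q.1 ∉ nball κ p

/-- The Besicovitch intersection property with constant `L`. -/
def IntersectionProperty (X : Type*) [MetricSpace X] (κ : BallKind) (L : ℕ) : Prop :=
  1 ≤ L ∧ ∀ C : Set (X × ℝ), IsBesicovitchFamily κ C → ∀ y : X, overlap κ C y ≤ (L : ℝ≥0∞)

/-- Geometrically doubling with constant `D`: each ball of radius `r` is covered by at most `D`
balls of radius `r / 2`. -/
def GeometricallyDoubling (X : Type*) [MetricSpace X] (κ : BallKind) (D : ℕ) : Prop :=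
  1 ≤ D ∧ ∀ (x : X) (r : ℝ), 0 < r →
    ∃ S : Finset X, S.card ≤ D ∧ nball κ (x, r) ⊆ ⋃ z ∈ S, nball κ (z, r / 2)

/-- The approximate midpoint property. -/
def ApproximateMidpointProperty (X : Type*) [MetricSpace X] : Prop :=
  ∀ ε : ℝ, 0 < ε → ∀ x y : X, ∃ z : X,
    dist x z < ε + dist x y / 2 ∧ dist z y < ε + dist x y / 2

end BesicovitchTypes

/-! (1) Radii need not attain a maximum, so balls are selected greedily in order of dyadic scale,
each scale being well-ordered arbitrarily. A rejected ball has its center covered; of two selected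
balls, the earlier misses the later center and has more than half the later radius. Among finitely
many selected balls through a point, an exact greedy choice by radius leaves a Besicovitch family,
so at most `L` balls, whose members contain all the centers; doubling bounds the centers in each
member (`card_centers_le`). (2) By doubling and approximate midpoints, few points meet every larger
ball that intersects a given one (`exists_piercing`). With bounded overlap, each ball then has
boundedly many larger neighbors in the intersection graph, and the color classes of a greedy
coloring are the disjoint subcollections. -/

namespace BesicovitchTypes

/-! ### Counting and graph coloring -/

section Finite

/-- A set each of whose finite subsets has at most `n` elements has at most `n` elements. -/
theorem encard_le_of_forall_finset {α : Type*} {S : Set α} {n : ℕ}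
    (h : ∀ F : Finset α, (F : Set α) ⊆ S → F.card ≤ n) : S.encard ≤ n := by
  by_contra! hlt
  obtain ⟨T, hTS, hT⟩ := Set.exists_subset_encard_eq (Order.add_one_le_of_lt hlt)
  have hfin : T.Finite := Set.finite_of_encard_eq_coe (k := n + 1) (by simpa using hT)
  have hcard := h hfin.toFinset (by simpa using hTS)
  have : ((hfin.toFinset.card : ℕ) : ℕ∞) = ((n + 1 : ℕ) : ℕ∞) := by
    rw [← hfin.encard_eq_coe_toFinset_card, hT]
    simp
  have := ENat.natCast_inj.1 this
  omega

/-- A finite set covered by at most `a` pieces of size at most `b` has at most `a * b` elements. -/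
theorem card_le_mul_of_cover {α β : Type*} (F : Finset α) (S : Finset β) (P : β → α → Prop)
    {a b : ℕ} (hS : S.card ≤ a) (hcov : ∀ q ∈ F, ∃ i ∈ S, P i q)
    (hb : ∀ i ∈ S, ∀ F' : Finset α, F' ⊆ F → (∀ q ∈ F', P i q) → F'.card ≤ b) :
    F.card ≤ a * b := by
  classical
  have hsub : F ⊆ S.biUnion fun i => F.filter (P i) := fun q hq => by
    obtain ⟨i, hi, hiq⟩ := hcov q hq
    exact Finset.mem_biUnion.2 ⟨i, hi, Finset.mem_filter.2 ⟨hq, hiq⟩⟩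
  calc F.card ≤ _ := Finset.card_le_card hsub
    _ ≤ S.card * b := Finset.card_biUnion_le_card_mul _ _ _ fun i hi =>
        hb i hi _ (Finset.filter_subset _ _) fun q hq => (Finset.mem_filter.1 hq).2
    _ ≤ a * b := Nat.mul_le_mul_right _ hS

/-- Greedy coloring of a finite set of vertices in order of decreasing weight. -/
theorem exists_coloring_finset {V : Type*} (G : SimpleGraph V) (f : V → ℝ) {K : ℕ}
    (hK : ∀ v, ∀ F : Finset V, (∀ w ∈ F, G.Adj v w ∧ f v ≤ f w) → F.card ≤ K) (s : Finset V) :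
    ∃ c : V → Fin (K + 1), ∀ v ∈ s, ∀ w ∈ s, G.Adj v w → c v ≠ c w := by
  classical
  induction s using Finset.induction_on_min_value f with
  | empty => exact ⟨fun _ => 0, by simp⟩
  | insert a s ha hmin ih =>
    obtain ⟨c, hc⟩ := ih
    -- Weights are inserted in decreasing order, so all colored neighbors of `a` count towards `K`
    -- and one of the `K + 1` colors is free.
    have hcard : ((s.filter (G.Adj a)).image c).card < (Finset.univ : Finset (Fin (K + 1))).card := by
      rw [Finset.card_univ, Fintype.card_fin, Nat.lt_succ_iff]
      refine Finset.card_image_le.trans (hK a _ fun w hw => ?_)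
      rw [Finset.mem_filter] at hw
      exact ⟨hw.2, hmin w hw.1⟩
    obtain ⟨k, -, hk⟩ := Finset.exists_mem_notMem_of_card_lt_card hcard
    have hk' : ∀ w ∈ s, G.Adj a w → c w ≠ k := fun w hw haw hwk =>
      hk (Finset.mem_image.2 ⟨w, Finset.mem_filter.2 ⟨hw, haw⟩, hwk⟩)
    have hne : ∀ w ∈ s, w ≠ a := fun w hw h => ha (h ▸ hw)
    refine ⟨Function.update c a k, fun v hv w hw hvw => ?_⟩
    rcases Finset.mem_insert.1 hv with rfl | hv' <;>
      rcases Finset.mem_insert.1 hw with rfl | hw'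
    · exact absurd hvw (G.irrefl)
    · rw [Function.update_self, Function.update_of_ne (hne w hw')]
      exact (hk' w hw' hvw).symm
    · rw [Function.update_self, Function.update_of_ne (hne v hv')]
      exact hk' v hv' hvw.symm
    · rw [Function.update_of_ne (hne w hw'), Function.update_of_ne (hne v hv')]
      exact hc v hv' w hw' hvw

/-- A graph in which every vertex has at most `K` neighbors of at least its own weight can be
colored with `K + 1` colors. -/
theorem colorable_of_card_adj_le {V : Type*} (G : SimpleGraph V) (f : V → ℝ) {K : ℕ}
    (hK : ∀ v, ∀ F : Finset V, (∀ w ∈ F, G.Adj v w ∧ f v ≤ f w) → F.card ≤ K) :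
    G.Colorable (K + 1) := by
  -- De Bruijn–Erdős compactness: coloring finite subgraphs is enough.
  refine SimpleGraph.nonempty_hom_of_forall_finite_subgraph_hom fun G' hG' => ?_
  have h := exists_coloring_finset G f hK hG'.toFinset
  refine ⟨fun v => h.choose v, fun {v w} hvw => ?_⟩
  exact h.choose_spec v (by simp) w (by simp) hvw.adj_sub

end Finite

/-! ### Transfinite greedy selection and dyadic scales -/

section Selection

/-- Greedy selection along a well-founded relation: an element is selected exactly when it is not
hit by a previously selected one. -/
theorem exists_greedy_selection {α : Type*} {r : α → α → Prop} (hr : WellFounded r)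
    (hit : α → α → Prop) :
    ∃ S : Set α, ∀ p, p ∈ S ↔ ∀ q ∈ S, r q p → ¬ hit q p := by
  refine ⟨{p | hr.fix (fun p s => ∀ q, ∀ h : r q p, s q h → ¬ hit q p) p}, fun p => ?_⟩
  simp only [Set.mem_ofPred_eq]
  rw [hr.fix_eq]
  exact ⟨fun h q hq hqp => h q hqp hq, fun h q hqp hq => h q hq hqp⟩

/-- A type with a grading by natural numbers has a well-ordering along which the grade is
nondecreasing. -/
theorem exists_wellFounded_of_grading {α : Type*} (g : α → ℕ) :
    ∃ r : α → α → Prop, WellFounded r ∧ (∀ p q, r p q → g p ≤ g q) ∧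
      ∀ p q, p ≠ q → r p q ∨ r q p := by
  refine ⟨InvImage (Prod.Lex (· < ·) WellOrderingRel) fun p => (g p, p),
    InvImage.wf _ (WellFounded.prod_lex Nat.lt_wfRel.wf WellOrderingRel.isWellOrder.wf), ?_, ?_⟩
  · intro p q h
    rcases (Prod.lex_def).1 h with h | h
    · exact h.le
    · exact h.1.le
  · intro p q hpq
    simp only [InvImage, Prod.lex_def]
    rcases lt_trichotomy (g p) (g q) with h | h | h
    · exact Or.inl (Or.inl h)
    · rcases trichotomous_of WellOrderingRel p q with h' | h' | h'
      · exact Or.inl (Or.inr ⟨h, h'⟩)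
      · exact absurd h' hpq
      · exact Or.inr (Or.inr ⟨h.symm, h'⟩)
    · exact Or.inr (Or.inl h)

/-- Dyadic scales of radii in `(0, R]`. -/
theorem exists_dyadic_scale {R : ℝ} (hR : 0 < R) :
    ∃ g : ℝ → ℕ, ∀ r s, 0 < r → r ≤ R → 0 < s → s ≤ R → g r ≤ g s → s < 2 * r := by
  have h : ∀ r, ∃ n : ℕ, 0 < r → r ≤ R → (1 / 2 : ℝ) ^ (n + 1) < r / R ∧ r / R ≤ (1 / 2) ^ n := by
    intro r
    by_cases hr : 0 < r ∧ r ≤ R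
    · obtain ⟨n, hn⟩ := exists_nat_pow_near_of_lt_one (div_pos hr.1 hR)
        ((div_le_one hR).2 hr.2) (by norm_num : (0 : ℝ) < 1 / 2) (by norm_num)
      exact ⟨n, fun _ _ => hn⟩
    · exact ⟨0, fun h1 h2 => absurd ⟨h1, h2⟩ hr⟩
  choose g hg using h
  refine ⟨g, fun r s hr hrR hs hsR hgrs => ?_⟩
  have h1 := (hg r hr hrR).1
  have h2 := (hg s hs hsR).2
  have h3 : (1 / 2 : ℝ) ^ g s ≤ (1 / 2) ^ g r :=
    pow_le_pow_of_le_one (by norm_num) (by norm_num) hgrs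
  rw [pow_succ] at h1
  have h4 : s / R < 2 * r / R := by
    rw [mul_div_assoc]
    linarith
  exact (div_lt_div_iff_of_pos_right hR).1 h4

end Selection

variable {X : Type*} [MetricSpace X] {κ : BallKind}

/-! ### Balls, overlap and iterated doubling -/

section Balls

theorem mem_nball_of_dist_lt {p : X × ℝ} {y : X} (h : dist p.1 y < p.2) : y ∈ nball κ p := by
  cases κ
  · exact h
  · exact le_of_lt h

theorem dist_le_of_mem_nball {p : X × ℝ} {y : X} (h : y ∈ nball κ p) : dist p.1 y ≤ p.2 := by
  cases κ
  · exact le_of_lt h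
  · exact h

theorem center_mem_nball {p : X × ℝ} (hp : 0 < p.2) : p.1 ∈ nball κ p :=
  mem_nball_of_dist_lt (by simpa using hp)

/-- Contrapositively, if the larger of two balls misses the other's center, so does the smaller. -/
theorem center_mem_nball_of_le {p q : X × ℝ} (h : p.1 ∈ nball κ q) (hqp : q.2 ≤ p.2) :
    q.1 ∈ nball κ p := by
  cases κ
  · exact (dist_comm q.1 p.1 ▸ h : dist p.1 q.1 < q.2).trans_le hqp
  · exact (dist_comm q.1 p.1 ▸ h : dist p.1 q.1 ≤ q.2).trans hqp

theorem overlap_le_iff {C : Set (X × ℝ)} {y : X} {n : ℕ} :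
    overlap κ C y ≤ (n : ℝ≥0∞) ↔
      ∀ F : Finset (X × ℝ), (F : Set (X × ℝ)) ⊆ C → (∀ p ∈ F, y ∈ nball κ p) → F.card ≤ n := by
  have hcast : overlap κ C y ≤ (n : ℝ≥0∞) ↔ {p ∈ C | y ∈ nball κ p}.encard ≤ n := by
    rw [overlap_eq_encard, ← ENat.toENNReal_coe, ENat.toENNReal_le]
  rw [hcast]
  constructor
  · intro h F hFC hy
    have : (F : Set (X × ℝ)).encard ≤ n :=
      (Set.encard_le_encard (t := {p ∈ C | y ∈ nball κ p})
        fun p hp => ⟨hFC hp, hy p hp⟩).trans h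
    rw [Set.encard_coe_eq_coe_finsetCard] at this
    exact_mod_cast this
  · exact fun h => encard_le_of_forall_finset fun F hF =>
      h F (fun p hp => (hF hp).1) fun p hp => (hF hp).2

theorem indicator_le_overlap_iff {A : Set X} {C : Set (X × ℝ)} {y : X} :
    A.indicator (fun _ => (1 : ℝ≥0∞)) y ≤ overlap κ C y ↔
      (y ∈ A → ∃ p ∈ C, y ∈ nball κ p) := by
  by_cases hy : y ∈ A
  · have : (1 : ℝ≥0∞) = ((1 : ℕ∞) : ℝ≥0∞) := by simp
    simp only [Set.indicator_of_mem hy, hy, forall_const]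
    rw [overlap_eq_encard, this, ENat.toENNReal_le, Set.one_le_encard_iff_nonempty]
    rfl
  · simp [hy]

/-- In a doubling space a ball of radius `r` is covered by `D ^ n` balls of radius `r / 2 ^ n`. -/
theorem GeometricallyDoubling.exists_cover {D : ℕ} (hD : GeometricallyDoubling X κ D) (n : ℕ)
    (x : X) {r : ℝ} (hr : 0 < r) :
    ∃ S : Finset X, S.card ≤ D ^ n ∧ nball κ (x, r) ⊆ ⋃ z ∈ S, nball κ (z, r / 2 ^ n) := by
  classical
  induction n with
  | zero => exact ⟨{x}, by simp, by simp⟩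
  | succ n ih =>
    obtain ⟨S, hS, hcov⟩ := ih
    choose T hT hTcov using fun z => hD.2 z (r / 2 ^ n) (by positivity)
    refine ⟨S.biUnion T, ?_, fun y hy => ?_⟩
    · rw [pow_succ]
      exact (Finset.card_biUnion_le_card_mul _ _ _ fun z _ => hT z).trans
        (Nat.mul_le_mul_right _ hS)
    · obtain ⟨z, hz, hyz⟩ := Set.mem_iUnion₂.1 (hcov hy)
      obtain ⟨w, hw, hyw⟩ := Set.mem_iUnion₂.1 (hTcov z hyz)
      refine Set.mem_iUnion₂.2 ⟨w, Finset.mem_biUnion.2 ⟨z, hz, hw⟩, ?_⟩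
      rwa [pow_succ, ← div_div]

end Balls

/-! ### From intersection to covering -/

section IntersectionToCovering

/-- A finite collection of balls has a Besicovitch subfamily whose balls contain all centers of the
collection, each center lying in a ball at least as large as its own. -/
theorem exists_besicovitch_subfamily (F : Finset (X × ℝ)) (hF : ∀ p ∈ F, 0 < p.2) :
    ∃ G ⊆ F, IsBesicovitchFamily κ (G : Set (X × ℝ)) ∧
      ∀ q ∈ F, ∃ p ∈ G, q.2 ≤ p.2 ∧ q.1 ∈ nball κ p := by
  classical
  induction F using Finset.induction_on_min_value (fun p : X × ℝ => p.2) with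
  | empty => exact ⟨∅, subset_rfl, ⟨by simp, by simp⟩, by simp⟩
  | insert a F ha hmin ih =>
    obtain ⟨G, hGF, hG, hcov⟩ := ih fun p hp => hF p (Finset.mem_insert_of_mem hp)
    have ha0 : 0 < a.2 := hF a (Finset.mem_insert_self _ _)
    by_cases h : ∃ p ∈ G, a.1 ∈ nball κ p
    · obtain ⟨p, hp, hap⟩ := h
      refine ⟨G, hGF.trans (Finset.subset_insert _ _), hG, fun q hq => ?_⟩
      rcases Finset.mem_insert.1 hq with rfl | hq
      · exact ⟨p, hp, hmin p (hGF hp), hap⟩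
      · exact hcov q hq
    · push Not at h
      have h' : ∀ p ∈ G, p.1 ∉ nball κ a := fun p hp hpa =>
        h p hp (center_mem_nball_of_le hpa (hmin p (hGF hp)))
      refine ⟨insert a G, Finset.insert_subset_insert _ hGF, ⟨?_, ?_⟩, fun q hq => ?_⟩
      · intro p hp
        exact hF p (Finset.insert_subset_insert _ hGF (Finset.mem_coe.1 hp))
      · intro p hp q hq hpq
        rcases Finset.mem_insert.1 (Finset.mem_coe.1 hp) with rfl | hp' <;>
          rcases Finset.mem_insert.1 (Finset.mem_coe.1 hq) with rfl | hq'
        · exact absurd rfl hpq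
        · exact ⟨h q hq', h' q hq'⟩
        · exact ⟨h' p hp', h p hp'⟩
        · exact hG.2 p hp' q hq' hpq
      · rcases Finset.mem_insert.1 hq with rfl | hq
        · exact ⟨q, Finset.mem_insert_self _ _, le_rfl, center_mem_nball ha0⟩
        · obtain ⟨p, hp, hpq⟩ := hcov q hq
          exact ⟨p, Finset.mem_insert_of_mem hp, hpq⟩

/-- At most `D ^ 2` balls of radius greater than `r / 2`, of any two of which one does not contain
the center of the other, have their centers in a given ball of radius `r`. -/
theorem GeometricallyDoubling.card_centers_le {D : ℕ} (hD : GeometricallyDoubling X κ D)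
    (p : X × ℝ) (hp : 0 < p.2) (F : Finset (X × ℝ)) (hmem : ∀ q ∈ F, q.1 ∈ nball κ p)
    (hrad : ∀ q ∈ F, p.2 < 2 * q.2)
    (hsep : ∀ q ∈ F, ∀ q' ∈ F, q ≠ q' → q'.1 ∉ nball κ q ∨ q.1 ∉ nball κ q') :
    F.card ≤ D ^ 2 := by
  obtain ⟨S, hS, hcov⟩ := hD.exists_cover 2 p.1 hp
  -- Two centers in one ball of radius `p.2 / 4` are within `p.2 / 2 < q.2`, so each such ball holds
  -- at most one center.
  have hclose : ∀ z, ∀ q ∈ F, ∀ q' ∈ F, q.1 ∈ nball κ (z, p.2 / 2 ^ 2) →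
      q'.1 ∈ nball κ (z, p.2 / 2 ^ 2) → q'.1 ∈ nball κ q := by
    intro z q hq q' hq' h h'
    have h1 := dist_le_of_mem_nball h
    have h2 := dist_le_of_mem_nball h'
    have h3 := dist_triangle_left q.1 q'.1 z
    have h4 := hrad q hq
    exact mem_nball_of_dist_lt (by simp only at h1 h2; linarith)
  have key := card_le_mul_of_cover F S (fun z q => q.1 ∈ nball κ (z, p.2 / 2 ^ 2)) (b := 1) hS
    (fun q hq => by simpa using hcov (hmem q hq)) ?_
  · simpa using key
  · intro z _ F' hF' hz
    refine Finset.card_le_one.2 fun q hq q' hq' => ?_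
    by_contra hne
    rcases hsep q (hF' hq) q' (hF' hq') hne with h | h
    · exact h (hclose z q (hF' hq) q' (hF' hq') (hz q hq) (hz q' hq'))
    · exact h (hclose z q' (hF' hq') q (hF' hq) (hz q' hq') (hz q hq))

theorem IntersectionProperty.coveringProperty {D L : ℕ} (hD : GeometricallyDoubling X κ D)
    (hL : IntersectionProperty X κ L) : CoveringProperty X κ (L * D ^ 3) := by
  refine ⟨Nat.mul_pos hL.1 (Nat.pow_pos hD.1), fun R hR A C hC => ?_⟩
  obtain ⟨g, hg⟩ := exists_dyadic_scale hR
  obtain ⟨r, hr, hrg, hrtot⟩ := exists_wellFounded_of_grading fun p : C => g p.1.2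
  obtain ⟨S, hS⟩ := exists_greedy_selection hr fun q p : C => p.1.1 ∈ nball κ q.1
  set C' : Set (X × ℝ) := Subtype.val '' S with hC'
  have hC'C : C' ⊆ C := by
    rintro _ ⟨p, -, rfl⟩
    exact p.2
  have hpos : ∀ p ∈ C', 0 < p.2 := fun p hp => (hC.1 p (hC'C hp)).2.1
  have hle : ∀ p ∈ C', p.2 ≤ R := fun p hp => (hC.1 p (hC'C hp)).2.2
  have hsel : ∀ p ∈ C', ∀ q ∈ C', p ≠ q →
      (p.2 < 2 * q.2 ∧ p.1 ∉ nball κ q) ∨ (q.2 < 2 * p.2 ∧ q.1 ∉ nball κ p) := by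
    intro p hp q hq hpq
    obtain ⟨p', hpS, rfl⟩ := hp
    obtain ⟨q', hqS, rfl⟩ := hq
    have hp := Set.mem_image_of_mem Subtype.val hpS
    have hq := Set.mem_image_of_mem Subtype.val hqS
    rcases hrtot p' q' (fun h => hpq (congrArg _ h)) with h | h
    · exact Or.inr ⟨hg _ _ (hpos _ hp) (hle _ hp) (hpos _ hq) (hle _ hq) (hrg _ _ h),
        (hS q').1 hqS p' hpS h⟩
    · exact Or.inl ⟨hg _ _ (hpos _ hq) (hle _ hq) (hpos _ hp) (hle _ hp) (hrg _ _ h),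
        (hS p').1 hpS q' hqS h⟩
  refine ⟨C', hC'C, fun y => ⟨indicator_le_overlap_iff.2 fun hy => ?_, overlap_le_iff.2 ?_⟩⟩
  · obtain ⟨s, hs⟩ := hC.2 y hy
    by_cases hmem : (⟨(y, s), hs⟩ : C) ∈ S
    · exact ⟨(y, s), ⟨_, hmem, rfl⟩, center_mem_nball (hC.1 _ hs).2.1⟩
    · rw [hS] at hmem
      push Not at hmem
      obtain ⟨q, hq, -, hyq⟩ := hmem
      exact ⟨q, ⟨q, hq, rfl⟩, hyq⟩
  · intro F hFC' hy
    obtain ⟨G, hGF, hG, hcov⟩ := exists_besicovitch_subfamily (κ := κ) F fun p hp =>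
      hpos p (hFC' hp)
    have hGL : G.card ≤ L := overlap_le_iff.1 (hL.2 _ hG y) G subset_rfl fun p hp => hy p (hGF hp)
    have key : F.card ≤ L * D ^ 2 := by
      refine card_le_mul_of_cover F G (fun p q => q.2 ≤ p.2 ∧ q.1 ∈ nball κ p) hGL hcov ?_
      intro p hp F' hF' hF'p
      have hpC' : p ∈ C' := hFC' (hGF hp)
      refine hD.card_centers_le p (hpos p hpC') F' (fun q hq => (hF'p q hq).2) ?_ ?_
      · intro q hq
        have hqC' : q ∈ C' := hFC' (hF' hq)
        have hq0 := hpos q hqC'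
        by_cases hpq : p = q
        · subst hpq
          linarith
        · rcases hsel p hpC' q hqC' hpq with h | h
          · exact h.1
          · exact absurd (hF'p q hq).2 h.2
      · intro q hq q' hq' hne
        rcases hsel q (hFC' (hF' hq)) q' (hFC' (hF' hq')) hne with h | h
        · exact Or.inr h.2
        · exact Or.inl h.2
    -- The argument gives `L * D ^ 2`, which is better than required.
    exact key.trans (Nat.mul_le_mul_left _ (Nat.pow_le_pow_right hD.1 (by norm_num)))

end IntersectionToCovering

/-! ### From covering to strong covering -/

section CoveringToStrong

/-- In a space with approximate midpoints, two points at distance less than `a + b` admit a point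
at distance less than `a` from the first one and less than `b` from the second one. -/
theorem ApproximateMidpointProperty.exists_between (hX : ApproximateMidpointProperty X) {x y : X}
    {a b : ℝ} (ha : 0 < a) (hb : 0 < b) (hab : dist x y < a + b) :
    ∃ w, dist x w < a ∧ dist w y < b := by
  -- Induction on the ratio of distance to slack `e = a + b - d`. If `e ≤ d`, passing to a
  -- near-midpoint leaves distance below `5 * d / 8` and slack above `3 * e / 4`, so the ratio
  -- shrinks by `5 / 6`. Once `d < e`, an endpoint works.
  have main : ∀ n : ℕ, ∀ (x y : X) (a b : ℝ), 0 < a → 0 < b → dist x y < a + b →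
      dist x y < (6 / 5 : ℝ) ^ n * (a + b - dist x y) → ∃ w, dist x w < a ∧ dist w y < b := by
    intro n
    induction n with
    | zero =>
      intro x y a b ha hb _ hn
      rw [pow_zero, one_mul] at hn
      rcases lt_or_ge (dist x y) a with h | h
      · exact ⟨y, h, by simpa using hb⟩
      · exact ⟨x, by simpa using ha, by linarith⟩
    | succ n ih =>
      intro x y a b ha hb hab hn
      set d := dist x y with hd
      set e := a + b - d with he
      have he0 : 0 < e := by linarith
      by_cases hde : d < e
      · rcases lt_or_ge d a with h | h
        · exact ⟨y, h, by simpa using hb⟩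
        · exact ⟨x, by simpa using ha, by linarith⟩
      push Not at hde
      obtain ⟨z, hxz, hzy⟩ := hX (e / 8) (by linarith) x y
      rw [← hd] at hxz hzy
      have hpow : (0 : ℝ) < (6 / 5) ^ n := by positivity
      rw [pow_succ] at hn
      have hbound : ∀ d' e' : ℝ, d' < e / 8 + d / 2 → 3 * e / 4 ≤ e' →
          d' < (6 / 5 : ℝ) ^ n * e' := by
        intro d' e' hd' he'
        have h1 : (6 / 5 : ℝ) ^ n * (3 * e / 4) ≤ (6 / 5 : ℝ) ^ n * e' :=
          mul_le_mul_of_nonneg_left he' hpow.le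
        linarith
      rcases lt_or_ge (e / 8 + d / 2) a with h | h
      · obtain ⟨w, hw1, hw2⟩ := ih z y (a - (e / 8 + d / 2)) b (by linarith) hb (by linarith)
          (hbound _ _ hzy (by linarith))
        exact ⟨w, by linarith [dist_triangle x z w], hw2⟩
      · obtain ⟨w, hw1, hw2⟩ := ih x z a (b - (e / 8 + d / 2)) ha (by linarith) (by linarith)
          (hbound _ _ hxz (by linarith))
        exact ⟨w, hw1, by linarith [dist_triangle w z y]⟩
  have hgap : 0 < a + b - dist x y := by linarith
  obtain ⟨n, hn⟩ := pow_unbounded_of_one_lt (dist x y / (a + b - dist x y))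
    (by norm_num : (1 : ℝ) < 6 / 5)
  exact main n x y a b ha hb hab ((div_lt_iff₀ hgap).1 hn)

/-- In a doubling space with approximate midpoints, `D ^ 3` points suffice to meet all the balls
that intersect a given ball and are at least as large. -/
theorem GeometricallyDoubling.exists_piercing {D : ℕ} (hD : GeometricallyDoubling X κ D)
    (hX : ApproximateMidpointProperty X) (p : X × ℝ) (hp : 0 < p.2) :
    ∃ S : Finset X, S.card ≤ D ^ 3 ∧
      ∀ q : X × ℝ, p.2 ≤ q.2 → ¬ Disjoint (nball κ p) (nball κ q) → ∃ z ∈ S, z ∈ nball κ q := by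
  obtain ⟨S, hS, hcov⟩ := hD.exists_cover 3 p.1 (r := 2 * p.2) (by linarith)
  refine ⟨S, hS, fun q hpq hdisj => ?_⟩
  obtain ⟨u, hup, huq⟩ := Set.not_disjoint_iff.1 hdisj
  have h1 := dist_le_of_mem_nball hup
  have h2 := dist_le_of_mem_nball huq
  have h3 := dist_triangle_right p.1 q.1 u
  -- The margin `p.2 / 4` is the radius of the covering balls: moving from `w` to the center `z` of
  -- one of them stays inside `q`.
  obtain ⟨w, hw1, hw2⟩ := hX.exists_between (x := p.1) (y := q.1) (a := 2 * p.2)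
    (b := q.2 - p.2 / 4) (by linarith) (by linarith) (by linarith)
  obtain ⟨z, hz, hwz⟩ := Set.mem_iUnion₂.1
    (hcov (mem_nball_of_dist_lt (p := (p.1, 2 * p.2)) hw1))
  have h4 : dist z w ≤ 2 * p.2 / 2 ^ 3 := dist_le_of_mem_nball hwz
  have h5 := dist_triangle z w q.1
  refine ⟨z, hz, mem_nball_of_dist_lt ?_⟩
  rw [dist_comm]
  linarith

theorem CoveringProperty.strongCoveringProperty {D N : ℕ} (hD : GeometricallyDoubling X κ D)
    (hN : CoveringProperty X κ N) (hX : ApproximateMidpointProperty X) :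
    StrongCoveringProperty X κ (D ^ 3 * N + 1) := by
  refine ⟨Nat.le_add_left _ _, fun R hR A C hC => ?_⟩
  obtain ⟨C', hC'C, hC'⟩ := hN.2 R hR A C hC
  let G : SimpleGraph C' :=
    { Adj := fun p q => p ≠ q ∧ ¬ Disjoint (nball κ p.1) (nball κ q.1)
      symm := ⟨fun p q h => ⟨h.1.symm, fun h' => h.2 h'.symm⟩⟩
      loopless := ⟨fun p h => h.1 rfl⟩ }
  have hG : G.Colorable (D ^ 3 * N + 1) := by
    refine colorable_of_card_adj_le G (fun p => p.1.2) fun v F hF => ?_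
    obtain ⟨S, hS, hpierce⟩ := hD.exists_piercing hX v.1 (hC.1 _ (hC'C v.2)).2.1
    refine card_le_mul_of_cover F S (fun z q => z ∈ nball κ q.1) hS
      (fun q hq => hpierce q (hF q hq).2 (hF q hq).1.2) fun z _ F' _ hz => ?_
    have := overlap_le_iff.1 (hC' z).2 (F'.map (Function.Embedding.subtype _))
      (by intro q hq; simp at hq; exact hq.1) (by simpa using fun a b h h' => hz ⟨(a, b), h⟩ h')
    simpa using this
  obtain ⟨c⟩ := hG
  refine ⟨_, le_rfl, fun i => Subtype.val '' {p : C' | c p = i}, fun i => ⟨?_, ?_⟩, fun y hy => ?_⟩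
  · rintro _ ⟨p, -, rfl⟩
    exact hC'C p.2
  · rintro _ ⟨p, hp, rfl⟩ _ ⟨q, hq, rfl⟩ hpq
    by_contra hdisj
    exact c.valid (show G.Adj p q from ⟨fun h => hpq (congrArg _ h), hdisj⟩)
      (hp.trans (Eq.symm hq))
  · obtain ⟨p, hp, hyp⟩ := indicator_le_overlap_iff.1 (hC' y).1 hy
    exact Set.mem_iUnion.2 ⟨c ⟨p, hp⟩, Set.mem_iUnion₂.2 ⟨p, ⟨⟨p, hp⟩, rfl, rfl⟩, hyp⟩⟩

end CoveringToStrong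

end BesicovitchTypes

theorem theorem4p3 {X : Type*} [MetricSpace X] (κ : BallKind) (D L : ℕ)
    (hD : BesicovitchTypes.GeometricallyDoubling X κ D) :
    (BesicovitchTypes.IntersectionProperty X κ L →
      BesicovitchTypes.CoveringProperty X κ (L * D ^ 3)) ∧
    (BesicovitchTypes.CoveringProperty X κ (L * D ^ 3) →
      BesicovitchTypes.ApproximateMidpointProperty X →
      BesicovitchTypes.StrongCoveringProperty X κ (L * D ^ 6 + 1)) := by
  refine ⟨fun hL => hL.coveringProperty hD, fun hN hX => ?_⟩
  have h := hN.strongCoveringProperty hD hX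
  rwa [show D ^ 3 * (L * D ^ 3) = L * D ^ 6 by ring] at h
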